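/- Conventions. $\overline B_d$ is the closed Euclidean unit ball of $\mathbb R^d$ and $\partial B_d$ the unit sphere in $\mathbb R^d$ (empty for $d=0$). An \emph{h-set} $N$ in $\mathbb R^n$ is a compact set, also denoted $N$, with integers $u(N),s(N)\ge 0$, $u(N)+s(N)=n$, and a homeomorphism $c_N:\mathbb R^n\to\mathbb R^{u(N)}\times\mathbb R^{s(N)}$ with $c_N(N)=N_c:=\overline B_{u(N)}\times\overline B_{s(N)}$. Put $N_c^-=\partial B_{u(N)}\times\overline B_{s(N)}$ and $N_c^+=\overline B_{u(N)}\times\partial B_{s(N)}$. The h-set $N^T$ is the same set with $u(N^T)=s(N)$, $s(N^T)=u(N)$, and $c_{N^T}=j\circ c_N$, where $j(p,q)=(q,p)$. Let $N,M$ be h-sets with $u(N)=u(M)=u$, $s(N)=s(M)=s$, and let $f$ be a map from a set $\Omega\subset\mathbb R^n$ to $\mathbb R^n$. $N$ \emph{$f$-covers} $M$ if $N\subset\Omega$, $f|_N$ is continuous, and, with $f_c=c_M\circ f\circ c_N^{-1}:N_c\to\mathbb R^u\times\mathbb R^s$, there are a continuous $h:[0,1]\times N_c\to\mathbb R^u\times\mathbb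 R^s$ and a linear map $L:\mathbb R^u\to\mathbb R^u$ such that $h_0=f_c$, $h([0,1],N_c^-)\cap M_c=\emptyset$, $h([0,1],N_c)\cap M_c^+=\emptyset$, $h_1(p,q)=(Lp,0)$ on $N_c$, and $L(\partial B_u)\subset\mathbb R^u\setminus\overline B_u$. $N$ \emph{$f$-backcovers} $M$ if $f^{-1}:M\to\mathbb R^n$ is well defined (each point of $M$ has exactly one preimage in $\Omega$) and continuous, and $M^T$ $f^{-1}$-covers $N^T$. An \emph{h-set with cones} is an h-set $N$ with a quadratic form $Q_N(x,y)=\alpha(x)-\beta(y)$ on $\mathbb R^{u(N)}\times\mathbb R^{s(N)}$, where $\alpha,\beta$ are positive definite. For h-sets with cones $N$, $M$, write $N\Longleftrightarrow M$ (a covering relation with cone condition) if either (a) $N$ $f$-covers $M$ and $Q_M(f_c(p_1)-f_c(p_2))>Q_N(p_1-p_2)$ for all $p_1\ne p_2$ in $N_c$, or (b) $N$ $f$-backcovers $M$ and $Q_M(q_1-q_2)>Q_N(f_c^{-1}(q_1)-f_c^{-1}(q_2))$ for all $q_1\neq q_2$ in $M_c$, where $f_c^{-1}=c_N\circ f^{-1}\circ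 c_M^{-1}$. \textbf{Theorem.} Let $A=(a_{ij})_{i,j=0}^{k-1}$ be a $k\times k$ matrix with entries in $\{0,1\}$, let $f:\Omega\subset\mathbb R^n\to\mathbb R^n$, and let $N_0,\dots,N_{k-1}$ be h-sets with cones in $\mathbb R^n$ such that $N_i\Longleftrightarrow N_j$ whenever $a_{ij}=1$. Then every sequence $\omega\in\{0,\dots,k-1\}^{\mathbb Z}$ with $a_{\omega_m\omega_{m+1}}=1$ for all $m\in\mathbb Z$ is realized by a unique orbit: there is exactly one sequence $(x_m)_{m\in\mathbb Z}$ in $\Omega$ with $f(x_m)=x_{m+1}$ and $x_m\in N_{\omega_m}$ for all $m\in\mathbb Z$. -/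

import Mathlib

noncomputable section

/-- An h-set in `ℝⁿ`: a compact set with dimensions `u + s = n` and a homeomorphism
`ℝⁿ → ℝᵘ × ℝˢ` taking the set onto the product of the closed Euclidean unit balls. -/
structure HSet (n : ℕ) where
  carrier : Set (EuclideanSpace ℝ (Fin n))
  isCompact : IsCompact carrier
  u : ℕ
  s : ℕ
  dim_eq : u + s = n
  c : EuclideanSpace ℝ (Fin n) ≃ₜ EuclideanSpace ℝ (Fin u) × EuclideanSpace ℝ (Fin s)
  image_eq : c '' carrier = Metric.closedBall 0 1 ×ˢ Metric.closedBall 0 1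

namespace HSet

variable {n : ℕ}

/-- The coordinate space `ℝᵘ × ℝˢ` of an h-set. -/
abbrev Coord (N : HSet n) : Type :=
  EuclideanSpace ℝ (Fin N.u) × EuclideanSpace ℝ (Fin N.s)

/-- `N_c`, the h-set in its own coordinates. -/
def box (N : HSet n) : Set N.Coord := Metric.closedBall 0 1 ×ˢ Metric.closedBall 0 1

/-- `N_c⁻`, the exit set in coordinates. -/
def exitSet (N : HSet n) : Set N.Coord := Metric.sphere 0 1 ×ˢ Metric.closedBall 0 1

/-- `N_c⁺`, the entrance set in coordinates. -/
def entranceSet (N : HSet n) : Set N.Coord := Metric.closedBall 0 1 ×ˢ Metric.sphere 0 1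

/-- The transposed h-set `Nᵀ`: same set, stable and unstable directions exchanged. -/
def transpose (N : HSet n) : HSet n where
  carrier := N.carrier
  isCompact := N.isCompact
  u := N.s
  s := N.u
  dim_eq := (Nat.add_comm N.s N.u).trans N.dim_eq
  c := N.c.trans (Homeomorph.prodComm _ _)
  image_eq := by
    have h : (fun x => (N.c.trans (Homeomorph.prodComm _ _)) x) '' N.carrier =
        Prod.swap '' (N.c '' N.carrier) := by
      rw [Set.image_image]; rfl
    rw [N.image_eq, Set.image_swap_prod] at h
    exact h

/-- The representation `f_c = c_M ∘ f ∘ c_N⁻¹` of a map in the coordinates of `N` and `M`. -/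
def localRep (f : EuclideanSpace ℝ (Fin n) → EuclideanSpace ℝ (Fin n)) (N M : HSet n) :
    N.Coord → M.Coord :=
  fun z => M.c (f (N.c.symm z))

/-- The map `f`, defined on `Ω`, satisfies the covering relation `N ⟹ M`. -/
structure Covers (Ω : Set (EuclideanSpace ℝ (Fin n)))
    (f : EuclideanSpace ℝ (Fin n) → EuclideanSpace ℝ (Fin n)) (N M : HSet n) : Prop where
  u_eq : N.u = M.u
  s_eq : N.s = M.s
  subset_domain : N.carrier ⊆ Ω
  continuousOn : ContinuousOn f N.carrier
  exists_homotopy : ∃ h : ℝ × N.Coord → M.Coord,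
    ContinuousOn h (Set.Icc 0 1 ×ˢ N.box) ∧
    (∀ z ∈ N.box, h (0, z) = localRep f N M z) ∧
    (∀ t ∈ Set.Icc (0 : ℝ) 1, ∀ z ∈ N.exitSet, h (t, z) ∉ M.box) ∧
    (∀ t ∈ Set.Icc (0 : ℝ) 1, ∀ z ∈ N.box, h (t, z) ∉ M.entranceSet) ∧
    ∃ A : EuclideanSpace ℝ (Fin N.u) →ₗ[ℝ] EuclideanSpace ℝ (Fin M.u),
      (∀ z ∈ N.box, h (1, z) = (A z.1, 0)) ∧
      ∀ p ∈ Metric.sphere (0 : EuclideanSpace ℝ (Fin N.u)) 1, A p ∉ Metric.closedBall 0 1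

/-- The map `f`, defined on `Ω`, satisfies the back-covering relation `N ⟸ M`: its inverse is
well defined on `M` (every point of `M` has exactly one preimage in `Ω`), continuous there, and
satisfies the covering relation `Mᵀ ⟹ Nᵀ`. On `M`, `Function.invFunOn f Ω` is that inverse. -/
structure BackCovers (Ω : Set (EuclideanSpace ℝ (Fin n)))
    (f : EuclideanSpace ℝ (Fin n) → EuclideanSpace ℝ (Fin n)) (N M : HSet n) : Prop where
  existsUnique_preimage : ∀ y ∈ M.carrier, ∃! x, x ∈ Ω ∧ f x = y
  inverse_covers : Covers M.carrier (Function.invFunOn f Ω) M.transpose N.transpose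

end HSet

/-- An h-set with cones: an h-set with the quadratic form `Q(x, y) = α x - β y`, where `α` and `β`
are positive definite. -/
structure HSetWithCones (n : ℕ) extends HSet n where
  α : QuadraticForm ℝ (EuclideanSpace ℝ (Fin u))
  β : QuadraticForm ℝ (EuclideanSpace ℝ (Fin s))
  α_posDef : α.PosDef
  β_posDef : β.PosDef

namespace HSetWithCones

variable {n : ℕ}

/-- The quadratic form `Q(x, y) = α x - β y` in coordinates. -/
def Q (N : HSetWithCones n) (z : N.toHSet.Coord) : ℝ := N.α z.1 - N.β z.2

/-- The cone condition for a covering relation `N ⟹ M`. -/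
def ConeCondition (f : EuclideanSpace ℝ (Fin n) → EuclideanSpace ℝ (Fin n))
    (N M : HSetWithCones n) : Prop :=
  ∀ p₁ ∈ N.toHSet.box, ∀ p₂ ∈ N.toHSet.box, p₁ ≠ p₂ →
    N.Q (p₁ - p₂) <
      M.Q (HSet.localRep f N.toHSet M.toHSet p₁ - HSet.localRep f N.toHSet M.toHSet p₂)

/-- The cone condition for a back-covering relation `N ⟸ M`. -/
def BackConeCondition (Ω : Set (EuclideanSpace ℝ (Fin n)))
    (f : EuclideanSpace ℝ (Fin n) → EuclideanSpace ℝ (Fin n)) (N M : HSetWithCones n) : Prop :=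
  ∀ q₁ ∈ M.toHSet.box, ∀ q₂ ∈ M.toHSet.box, q₁ ≠ q₂ →
    N.Q (HSet.localRep (Function.invFunOn f Ω) M.toHSet N.toHSet q₁ -
        HSet.localRep (Function.invFunOn f Ω) M.toHSet N.toHSet q₂) <
      M.Q (q₁ - q₂)

/-- `N ⟺ M` with cone conditions: `N` covers or back-covers `M` under `f`, and `f` satisfies
the cone condition belonging to that relation. -/
def GenCoversWithCones (Ω : Set (EuclideanSpace ℝ (Fin n)))
    (f : EuclideanSpace ℝ (Fin n) → EuclideanSpace ℝ (Fin n)) (N M : HSetWithCones n) : Prop :=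
  (HSet.Covers Ω f N.toHSet M.toHSet ∧ ConeCondition f N M) ∨
    (HSet.BackCovers Ω f N.toHSet M.toHSet ∧ BackConeCondition Ω f N M)

end HSetWithCones

/-- The space of the topological Markov chain `σ_A`: the bi-infinite sequences `ω` with
`a (ω m) (ω (m + 1)) = 1` for all `m`. -/
def markovSequences {k : ℕ} (A : Matrix (Fin k) (Fin k) ℕ) : Set (ℤ → Fin k) :=
  {ω | ∀ m, A (ω m) (ω (m + 1)) = 1}

/-- A bi-infinite orbit of a map `f` defined on `Ω`. -/
def IsOrbit {X : Type*} (Ω : Set X) (f : X → X) (x : ℤ → X) : Prop :=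
  ∀ m, x m ∈ Ω ∧ f (x m) = x (m + 1)

end

/-! Existence. Each relation between consecutive sets becomes a link: an equation `a = 0` for the
unstable coordinate of the earlier point and an equation `b = 0` for the stable coordinate of the
later one. Covering and back-covering give links of the same form, the latter by exchanging the two
points and the two directions. In a window of consecutive times each interior coordinate has exactly
one equation, and the free coordinates at the ends are set to zero. The links deform this system to
the identity with no zero on the boundary of the product of boxes, so a Brouwer-type argument gives
a zero (`exists_zero_of_finite_window`); compactness passes to all of `ℤ` (`exists_zero_of_links`).

Uniqueness. Along two orbits with the same itinerary, `gap` (the form `Q` of the difference in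
coordinates) is bounded, nondecreasing, and strictly increasing at every time where the orbits
differ. Compactness, with finitely many pairs of sets, gives a uniform increment while `gap` stays
away from zero. So `gap` vanishes identically (`eq_zero_of_monotone_of_abs_le`), which contradicts
strict growth unless the orbits agree. -/

section

open MeasureTheory Metric Set Topology Filter

/-! ### Brouwer-type zero theorem by the Milnor–Rogers volume argument -/

/-- Lagrange interpolation expresses `det (1 + B)` through the values of `det (1 + t B)` at finitely
many arbitrarily small `t > 0`. -/
theorem exists_interpolation_det_one_add_smul {E : Type*} [NormedAddCommGroup E] [NormedSpace ℝ E]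
    [FiniteDimensional ℝ E] {δ : ℝ} (hδ : 0 < δ) :
    ∃ (s : Finset ℕ) (t c : ℕ → ℝ), (∀ i ∈ s, 0 < t i ∧ t i < δ) ∧ ∑ i ∈ s, c i = 1 ∧
      ∀ B : E →L[ℝ] E, (1 + B).det = ∑ i ∈ s, c i * (1 + t i • B).det := by
  classical
  set d := Module.finrank ℝ E
  let b := Module.finBasis ℝ E
  -- The shift by 2 keeps even the node `i = 0` strictly below `δ`.
  let t : ℕ → ℝ := fun i => δ / (i + 2)
  have ht : Function.Injective t := by
    intro i j hij
    have hi : (0 : ℝ) < i + 2 := by positivity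
    have hj : (0 : ℝ) < j + 2 := by positivity
    simp only [t] at hij
    rw [div_eq_div_iff hi.ne' hj.ne'] at hij
    have := mul_left_cancel₀ hδ.ne' hij
    exact_mod_cast (by linarith : (i : ℝ) = j)
  have hinj : Set.InjOn t (Finset.range (d + 1)) := ht.injOn
  refine ⟨Finset.range (d + 1), t,
    fun i => (Lagrange.basis (Finset.range (d + 1)) t i).eval 1, ?_, ?_, ?_⟩
  · intro i _
    refine ⟨by positivity, ?_⟩
    rw [div_lt_iff₀ (by positivity)]
    nlinarith [(Nat.cast_nonneg i : (0 : ℝ) ≤ i)]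
  · rw [← Polynomial.eval_finsetSum, Lagrange.sum_basis hinj (by simp), Polynomial.eval_one]
  · intro B
    let M := LinearMap.toMatrix b b (B : E →ₗ[ℝ] E)
    -- `det (1 + x B)` is a polynomial in `x` of degree at most `d`, so `d + 1` nodes determine it.
    let p : Polynomial ℝ := Matrix.det ((Polynomial.X : Polynomial ℝ) • M.map Polynomial.C
      + (1 : Matrix _ _ ℝ).map Polynomial.C)
    have hp : ∀ x : ℝ, (1 + x • B).det = p.eval x := by
      intro x
      have h1 : p.eval x = (x • M + 1).det := by
        rw [show p.eval x = Polynomial.evalRingHom x p from rfl, RingHom.map_det]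
        congr 1
        ext i j
        by_cases hij : i = j
        · subst hij
          simp [mul_comm x]
        · simp [hij, mul_comm x]
      have h2 : LinearMap.toMatrix b b ((1 + x • B : E →L[ℝ] E) : E →ₗ[ℝ] E) = x • M + 1 := by
        rw [add_comm]
        simp only [ContinuousLinearMap.toLinearMap_add, ContinuousLinearMap.toLinearMap_smul,
          map_add, map_smul]
        exact congrArg _ (LinearMap.toMatrix_one b)
      rw [h1, ← h2, LinearMap.det_toMatrix]
    have hdeg : p.degree < (Finset.range (d + 1)).card := by
      refine lt_of_le_of_lt Polynomial.degree_le_natDegree ?_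
      have := Polynomial.natDegree_det_X_add_C_le M 1
      rw [Fintype.card_fin] at this
      rw [Finset.card_range]
      exact_mod_cast Nat.lt_succ_of_le this
    have h1 : (1 + B).det = p.eval 1 := by rw [← hp, one_smul]
    rw [h1, Lagrange.eq_interpolate hinj hdeg, Lagrange.interpolate_apply,
      Polynomial.eval_finsetSum]
    refine Finset.sum_congr rfl fun i hi => ?_
    rw [Polynomial.eval_mul, Polynomial.eval_C, hp, mul_comm]

theorem exists_mem_segment_norm_eq {E : Type*} [NormedAddCommGroup E] [NormedSpace ℝ E]
    {ρ : ℝ} {x y : E} (hx : ‖x‖ ≤ ρ) (hy : ρ ≤ ‖y‖) : ∃ w, ‖w‖ = ρ ∧ ‖x - w‖ ≤ ‖x - y‖ := by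
  have hc : ContinuousOn (fun t : ℝ => ‖x + t • (y - x)‖) (Icc 0 1) := by fun_prop
  obtain ⟨t, ht, h⟩ := intermediate_value_Icc zero_le_one hc
    (show ρ ∈ Icc _ _ by simpa using ⟨hx, hy⟩)
  refine ⟨_, h, ?_⟩
  rw [sub_add_cancel_left, norm_neg, norm_smul, norm_sub_rev, Real.norm_of_nonneg ht.1]
  exact mul_le_of_le_one_left (norm_nonneg _) ht.2

/-- A segment leaving the ball crosses the sphere, where `g` vanishes, so the value at the inner
endpoint is controlled by its distance to the crossing point. -/
theorem LipschitzOnWith.indicator_closedBall {E F : Type*} [NormedAddCommGroup E]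
    [NormedSpace ℝ E] [NormedAddCommGroup F] {ρ : ℝ} {C : NNReal} {g : E → F}
    (hg : LipschitzOnWith C g (closedBall 0 ρ)) (h0 : ∀ z, ‖z‖ = ρ → g z = 0) :
    LipschitzWith C ((closedBall 0 ρ).indicator g) := by
  have key : ∀ x y : E, ‖x‖ ≤ ρ → ρ ≤ ‖y‖ → ‖g x‖ ≤ C * ‖x - y‖ := by
    intro x y hx hy
    obtain ⟨w, hw, hxw⟩ := exists_mem_segment_norm_eq hx hy
    have := hg.dist_le_mul x (by simpa using hx) w (by simpa using hw.le)
    rw [h0 w hw, dist_zero_right, dist_eq_norm] at this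
    exact this.trans (by gcongr)
  refine LipschitzWith.of_dist_le_mul fun x y => ?_
  by_cases hx : x ∈ closedBall (0 : E) ρ <;> by_cases hy : y ∈ closedBall (0 : E) ρ
  · simpa [hx, hy] using hg.dist_le_mul x hx y hy
  · rw [indicator_of_mem hx, indicator_of_notMem hy, dist_zero_right, dist_eq_norm]
    simp only [mem_closedBall, dist_zero_right, not_le] at hx hy
    exact key x y hx hy.le
  · rw [indicator_of_notMem hx, indicator_of_mem hy, dist_zero_left, dist_comm, dist_eq_norm]
    simp only [mem_closedBall, dist_zero_right, not_le] at hx hy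
    exact key y x hy hx.le
  · simp only [indicator_of_notMem hx, indicator_of_notMem hy, dist_self]
    positivity

theorem LipschitzWith.bijective_id_add {E : Type*} [NormedAddCommGroup E] [NormedSpace ℝ E]
    [CompleteSpace E] {c : NNReal} {φ : E → E} (hφ : LipschitzWith c φ) (hc : c < 1) :
    Function.Bijective (fun z => z + φ z) := by
  have happ : ApproximatesLinearOn (fun z => z + φ z)
      ((ContinuousLinearEquiv.refl ℝ E : E ≃L[ℝ] E) : E →L[ℝ] E) univ c := by
    rw [ApproximatesLinearOn.approximatesLinearOn_iff_lipschitzOnWith, lipschitzOnWith_univ]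
    convert! hφ using 1
    ext z
    simp
  have hc' : Subsingleton E ∨
      c < ‖((ContinuousLinearEquiv.refl ℝ E : E ≃L[ℝ] E).symm : E →L[ℝ] E)‖₊⁻¹ := by
    rcases subsingleton_or_nontrivial E with h | h
    · exact Or.inl h
    · right
      have : ‖((ContinuousLinearEquiv.refl ℝ E : E ≃L[ℝ] E).symm : E →L[ℝ] E)‖₊ = 1 := by
        have h := ContinuousLinearMap.norm_id (𝕜 := ℝ) (E := E)
        exact NNReal.eq h
      rw [this]
      simpa using hc
  exact ⟨injOn_univ.1 (happ.injOn hc'), happ.surjective hc'⟩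

theorem Function.Bijective.image_eq_of_forall_notMem {α : Type*} {f : α → α} {s : Set α}
    (hf : Function.Bijective f) (h : ∀ x ∉ s, f x = x) : f '' s = s := by
  apply Subset.antisymm
  · rintro _ ⟨x, hx, rfl⟩
    by_contra hfx
    have := hf.1 (h _ hfx)
    exact hfx (this.symm ▸ hx)
  · intro y hy
    obtain ⟨x, rfl⟩ := hf.2 y
    by_cases hx : x ∈ s
    · exact mem_image_of_mem f hx
    · rw [h x hx] at hy
      exact absurd hy hx

/-- There is no `C¹` retraction onto a sphere. -/
theorem not_contDiff_retraction_sphere {E : Type*} [NormedAddCommGroup E] [InnerProductSpace ℝ E]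
    [FiniteDimensional ℝ E] {ρ : ℝ} (hρ : 0 < ρ) {r : E → E} (hr : ContDiff ℝ 1 r)
    (hnorm : ∀ z, ‖r z‖ = ρ) (hid : ∀ z, ‖z‖ = ρ → r z = z) : False := by
  borelize E
  have : MeasureSpace E := measureSpaceOfInnerProductSpace
  let μ : Measure E := Measure.addHaar
  let B : E → E →L[ℝ] E := fun z => fderiv ℝ r z - 1
  have hB : Continuous B := (hr.continuous_fderiv one_ne_zero).sub continuous_const
  obtain ⟨C, hC⟩ : ∃ C, LipschitzOnWith C (fun z => r z - z) (closedBall 0 ρ) :=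
    (hr.sub contDiff_id).contDiffOn.exists_lipschitzOnWith one_ne_zero (convex_closedBall _ _)
      (isCompact_closedBall _ _)
  have hφ := hC.indicator_closedBall (fun z hz => by rw [hid z hz, sub_self])
  set φ := (closedBall (0 : E) ρ).indicator (fun z => r z - z)
  have hcdet : Continuous fun A : E →L[ℝ] E => A.det := ContinuousLinearMap.continuous_det
  have hdet : ∀ᶠ t : ℝ in 𝓝 0, ∀ z ∈ closedBall (0 : E) ρ, 0 < (1 + t • B z).det := by
    refine (isCompact_closedBall (0 : E) ρ).eventually_forall_of_forall_eventually fun z _ => ?_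
    have hc : Continuous fun p : ℝ × E => (1 + p.1 • B p.2).det :=
      hcdet.comp (by fun_prop)
    have h0 : 0 < (1 + (0 : ℝ) • B z).det := by
      simp [ContinuousLinearMap.det]
    exact hc.continuousAt.eventually (lt_mem_nhds h0)
  have hlip : ∀ᶠ t : ℝ in 𝓝 0, ‖t‖₊ * C < 1 := by
    have hc : Continuous fun t : ℝ => ‖t‖₊ * C := by fun_prop
    exact hc.continuousAt.eventually (gt_mem_nhds (by simp))
  obtain ⟨δ, hδ, hsmall⟩ := Metric.eventually_nhds_iff.1 (hdet.and hlip)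
  -- For small `t` the map `z + t φ z` is a bijection fixing everything outside the open ball, so it
  -- carries the ball onto itself, and its Jacobian integrates to the volume of the ball.
  have hvol : ∀ t : ℝ, 0 < t → t < δ →
      ∫ z in ball (0 : E) ρ, (1 + t • B z).det ∂μ = μ.real (ball 0 ρ) := by
    intro t ht htδ
    obtain ⟨hpos, hl⟩ := hsmall (y := t) (by simpa [abs_of_pos ht] using htδ)
    have hbij : Function.Bijective (fun z => z + t • φ z) :=
      ((lipschitzWith_smul t).comp hφ).bijective_id_add hl
    have himg : (fun z => z + t • φ z) '' ball 0 ρ = ball 0 ρ := by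
      refine hbij.image_eq_of_forall_notMem fun z hz => ?_
      have : φ z = 0 := by
        by_cases hz' : z ∈ closedBall (0 : E) ρ
        · simp only [φ, indicator_of_mem hz']
          rw [hid z, sub_self]
          simp only [mem_ball, mem_closedBall, dist_zero_right, not_lt] at hz hz'
          exact le_antisymm hz' hz
        · exact indicator_of_notMem hz' _
      simp [this]
    have hderiv : ∀ z ∈ ball (0 : E) ρ,
        HasFDerivWithinAt (fun z => z + t • φ z) (1 + t • B z) (ball 0 ρ) z := by
      intro z hz
      have h1 : HasFDerivAt (fun z => z + t • (r z - z)) (1 + t • B z) z := by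
        have hrz := (hr.differentiable one_ne_zero z).hasFDerivAt
        exact (hasFDerivAt_id z).add ((hrz.sub (hasFDerivAt_id z)).const_smul t)
      refine h1.hasFDerivWithinAt.congr (fun w hw => ?_) ?_
      · simp only [φ, indicator_of_mem (ball_subset_closedBall hw)]
      · simp only [φ, indicator_of_mem (ball_subset_closedBall hz)]
    have := integral_image_eq_integral_abs_det_fderiv_smul μ measurableSet_ball hderiv
      (hbij.1.injOn) (fun _ => (1 : ℝ))
    rw [himg] at this
    simp only [integral_const, smul_eq_mul, mul_one, MeasurableSet.univ, measureReal_restrict_apply,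
      univ_inter] at this
    rw [this]
    refine setIntegral_congr_fun measurableSet_ball fun z hz => ?_
    exact (abs_of_pos (hpos z (ball_subset_closedBall hz))).symm
  obtain ⟨s, t, c, ht, hc, hint⟩ := exists_interpolation_det_one_add_smul (E := E) hδ
  -- As `‖r‖` is constant, the range of the derivative is orthogonal to `r z ≠ 0`, so the derivative
  -- is not surjective.
  have hzero : ∀ z, (1 + B z).det = 0 := by
    intro z
    have hrz := (hr.differentiable one_ne_zero z).hasFDerivAt
    have horth : ∀ v, inner ℝ (r z) (fderiv ℝ r z v) = 0 := by
      intro v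
      have h1 := hrz.norm_sq
      have h2 : (fun x => ‖r x‖ ^ 2) = fun _ => ρ ^ 2 := by
        ext x
        rw [hnorm]
      rw [h2] at h1
      have h3 := congrArg (fun T : E →L[ℝ] ℝ => T v) (h1.unique (hasFDerivAt_const _ _))
      simpa using h3
    have hB1 : 1 + B z = fderiv ℝ r z := add_sub_cancel _ _
    rw [hB1]
    by_contra hne
    obtain ⟨v, hv⟩ := (LinearMap.equivOfDetNeZero _ hne).surjective (r z)
    have h := horth v
    rw [show fderiv ℝ r z v = r z from hv, real_inner_self_eq_norm_sq, hnorm] at h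
    exact hρ.ne' (pow_eq_zero_iff two_ne_zero |>.1 h)
  have hintegrable : ∀ t : ℝ, IntegrableOn (fun z => (1 + t • B z).det) (ball 0 ρ) μ := by
    intro t
    have hcont : Continuous fun z => (1 + t • B z).det := hcdet.comp (by fun_prop)
    exact (hcont.continuousOn.integrableOn_compact (isCompact_closedBall (0 : E) ρ)).mono_set
      ball_subset_closedBall
  -- The integral is polynomial in `t`, so its constancy for small `t` persists at `t = 1`, where
  -- the integrand is zero.
  have hfin : ∫ z in ball (0 : E) ρ, (1 + B z).det ∂μ = μ.real (ball 0 ρ) := by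
    rw [funext fun z => hint (B z)]
    rw [integral_finsetSum _ fun i _ => (hintegrable (t i)).const_mul (c i)]
    simp_rw [integral_const_mul]
    rw [Finset.sum_congr rfl fun i hi => by rw [hvol (t i) (ht i hi).1 (ht i hi).2],
      ← Finset.sum_mul, hc, one_mul]
  simp only [hzero, integral_zero] at hfin
  have hpos : 0 < μ.real (ball (0 : E) ρ) :=
    ENNReal.toReal_pos (measure_ball_pos μ _ hρ).ne' measure_ball_lt_top.ne
  exact hpos.ne hfin

/-- If `G` had no zero, a `C¹` approximation with error below `‖G‖` would have none either; rescaled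
to constant norm it would be a retraction onto a large sphere. -/
theorem exists_zero_of_eq_self_of_le_norm_of_inner {E : Type*} [NormedAddCommGroup E]
    [InnerProductSpace ℝ E] [FiniteDimensional ℝ E] {G : E → E} (hG : Continuous G) {R : ℝ}
    (hid : ∀ z, R ≤ ‖z‖ → G z = z) : ∃ z, G z = 0 := by
  by_contra! hne
  obtain ⟨g, hg, hdist, heq, -⟩ := hG.exists_contDiff_approx_and_eqOn 1
    (ε := fun z => ‖G z‖) hG.norm (fun z => norm_pos_iff.2 (hne z))
    (S := (ball 0 (R + 1))ᶜ) (U := (closedBall 0 R)ᶜ) isOpen_ball.isClosed_compl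
    (isClosed_closedBall.isOpen_compl.mem_nhdsSet.2 <| compl_subset_compl.2 <|
      closedBall_subset_ball (by linarith))
    (contDiffOn_id.congr fun z hz => hid z (by simpa using (le_of_lt (by simpa using hz))))
  have hg0 : ∀ z, g z ≠ 0 := by
    intro z hz
    have := hdist z
    rw [hz, dist_zero_left] at this
    exact lt_irrefl _ this
  -- The absolute value covers negative `R`. On this sphere the approximation still equals the
  -- identity.
  have hρ : 0 < |R| + 1 := by positivity
  refine not_contDiff_retraction_sphere hρ (r := fun z => ((|R| + 1) * ‖g z‖⁻¹) • g z) ?_ ?_ ?_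
  · have hn : ContDiff ℝ 1 fun z => ‖g z‖ := hg.norm ℝ hg0
    exact (contDiff_const.mul (hn.inv fun z => norm_ne_zero_iff.2 (hg0 z))).smul hg
  · intro z
    have := norm_ne_zero_iff.2 (hg0 z)
    rw [norm_smul, norm_mul, norm_inv, norm_norm, mul_assoc, inv_mul_cancel₀ this, mul_one,
      Real.norm_of_nonneg hρ.le]
  · intro z hz
    have h1 : R ≤ |R| := le_abs_self R
    have h2 : g z = z := by
      rw [heq (by simpa [hz] using h1), hid z (by linarith)]
    simp only [h2, hz, mul_inv_cancel₀ hρ.ne', one_smul]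

/-- A continuous self-map of a finite-dimensional space that is the identity outside a ball has a
zero. -/
theorem exists_zero_of_eq_self_of_le_norm {E : Type*} [NormedAddCommGroup E]
    [NormedSpace ℝ E] [FiniteDimensional ℝ E] {G : E → E} (hG : Continuous G) {R : ℝ}
    (hid : ∀ z, R ≤ ‖z‖ → G z = z) : ∃ z, G z = 0 := by
  let e : E ≃L[ℝ] EuclideanSpace ℝ (Fin (Module.finrank ℝ E)) := toEuclidean
  let L : E →L[ℝ] EuclideanSpace ℝ (Fin (Module.finrank ℝ E)) := e
  obtain ⟨w, hw⟩ := exists_zero_of_eq_self_of_le_norm_of_inner (G := fun w => e (G (e.symm w)))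
    (by fun_prop) (R := ‖L‖ * |R| + 1) (fun w hw => by
      rw [hid, e.apply_symm_apply]
      by_contra! hR
      have h1 : ‖w‖ ≤ ‖L‖ * ‖e.symm w‖ := by
        simpa [L] using L.le_opNorm (e.symm w)
      have h2 : ‖L‖ * ‖e.symm w‖ ≤ ‖L‖ * |R| :=
        mul_le_mul_of_nonneg_left (hR.le.trans (le_abs_self R)) (norm_nonneg _)
      linarith)
  exact ⟨e.symm w, by simpa using hw⟩

/-! ### Zeros from homotopies -/

/-- If the identity of the unit ball can be deformed to `F (0, ·)` without zeros on the unit sphere,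
then `F (0, ·)` has a zero. -/
theorem exists_zero_of_homotopy_id {E : Type*} [NormedAddCommGroup E]
    [NormedSpace ℝ E] [FiniteDimensional ℝ E] {F : ℝ × E → E}
    (hF : ContinuousOn F (Icc 0 1 ×ˢ closedBall 0 1))
    (hid : ∀ z ∈ closedBall (0 : E) 1, F (1, z) = z)
    (hne : ∀ t ∈ Icc (0 : ℝ) 1, ∀ z ∈ sphere (0 : E) 1, F (t, z) ≠ 0) :
    ∃ z ∈ closedBall (0 : E) 1, F (0, z) = 0 := by
  let ρ : E → E := fun z => (max 1 ‖z‖)⁻¹ • z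
  have hmax : ∀ z : E, 0 < max 1 ‖z‖ := fun z => lt_max_of_lt_left one_pos
  have hρc : Continuous ρ := by
    have : Continuous fun z : E => (max 1 ‖z‖)⁻¹ :=
      (continuous_const.max continuous_norm).inv₀ fun z => (hmax z).ne'
    exact this.smul continuous_id
  have hρ1 : ∀ z, ‖z‖ ≤ 1 → ρ z = z := fun z hz => by simp [ρ, max_eq_left hz]
  have hρmem : ∀ z, ρ z ∈ closedBall (0 : E) 1 := by
    intro z
    rw [mem_closedBall_zero_iff, norm_smul, norm_inv, Real.norm_of_nonneg (hmax z).le,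
      inv_mul_le_one₀ (hmax z)]
    exact le_max_right _ _
  -- `K` collects the zeros of all stages of the homotopy. A Urysohn function that is 0 on `K` and 1
  -- off the open ball serves as the time: the resulting map is the identity off the ball, and any
  -- zero of it inside lies in `K`, hence has time 0.
  let K : Set E := Prod.snd '' ((Icc (0 : ℝ) 1 ×ˢ closedBall (0 : E) 1) ∩ F ⁻¹' {0})
  have hK : IsCompact K := by
    refine IsCompact.image ?_ continuous_snd
    exact (isCompact_Icc.prod (isCompact_closedBall 0 1)).of_isClosed_subset
      (hF.preimage_isClosed_of_isClosed (isClosed_Icc.prod isClosed_closedBall) isClosed_singleton)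
      inter_subset_left
  have hdisj : Disjoint K (ball (0 : E) 1)ᶜ := by
    rw [Set.disjoint_left]
    rintro _ ⟨⟨t, z⟩, ⟨⟨ht, hz⟩, h0⟩, rfl⟩ hz'
    simp only [mem_compl_iff, mem_ball_zero_iff, not_lt] at hz'
    exact hne t ht z (mem_sphere_zero_iff_norm.2
      (le_antisymm (mem_closedBall_zero_iff.1 hz) hz')) h0
  obtain ⟨lam, hl0, hl1, hl⟩ := exists_continuous_zero_one_of_isClosed hK.isClosed
    isOpen_ball.isClosed_compl hdisj
  obtain ⟨z, hz⟩ := exists_zero_of_eq_self_of_le_norm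
    (G := fun z => F (lam z, ρ z) + (z - ρ z)) (R := 1)
    ((hF.comp_continuous (by fun_prop) fun z => ⟨hl z, hρmem z⟩).add (by fun_prop))
    (fun z hz => by
      have : lam z = 1 := hl1 (by simpa using hz)
      rw [this, hid _ (hρmem z), add_sub_cancel])
  by_cases hz1 : ‖z‖ < 1
  · have hzc : z ∈ closedBall (0 : E) 1 := by simpa using hz1.le
    rw [hρ1 z hz1.le, sub_self, add_zero] at hz
    refine ⟨z, hzc, ?_⟩
    have : lam z = 0 := hl0 ⟨(lam z, z), ⟨⟨hl z, hzc⟩, hz⟩, rfl⟩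
    rwa [this] at hz
  · exfalso
    push Not at hz1
    have h1 : lam z = 1 := hl1 (by simpa using hz1)
    rw [h1, hid _ (hρmem z), add_sub_cancel] at hz
    rw [hz, norm_zero] at hz1
    linarith

/-! ### The link of a single covering relation -/

theorem LinearMap.norm_lt_norm_of_sphere {U U' : Type*} [NormedAddCommGroup U] [NormedSpace ℝ U]
    [NormedAddCommGroup U'] [NormedSpace ℝ U'] {A : U →ₗ[ℝ] U'}
    (hA : ∀ p ∈ sphere (0 : U) 1, A p ∉ closedBall 0 1) {p : U} (hp : p ≠ 0) : ‖p‖ < ‖A p‖ := by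
  have hn := norm_pos_iff.2 hp
  have h := hA (‖p‖⁻¹ • p) (by simp [norm_smul, inv_mul_cancel₀ hn.ne'])
  rw [mem_closedBall_zero_iff, map_smul, norm_smul, norm_inv, norm_norm, not_le,
    lt_inv_mul_iff₀ hn, mul_one] at h
  exact h

/-- The expanding map `A` is injective, hence invertible by equality of dimensions, and its inverse
contracts. The first half of the deformation runs `h`, and its zeros are the solutions of `h (2t, z)
= w`; the second half removes the unstable part of `w` from the linear equation. -/
theorem exists_link_of_homotopy {U S U' S' : Type*} [NormedAddCommGroup U] [NormedSpace ℝ U]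
    [FiniteDimensional ℝ U] [NormedAddCommGroup S]
    [NormedAddCommGroup U'] [NormedSpace ℝ U'] [FiniteDimensional ℝ U'] [NormedAddCommGroup S']
    (hdim : Module.finrank ℝ U = Module.finrank ℝ U')
    {h : ℝ × U × S → U' × S'} (hc : ContinuousOn h (Icc 0 1 ×ˢ closedBall 0 1))
    (hexit : ∀ t ∈ Icc (0 : ℝ) 1, ∀ z ∈ closedBall (0 : U × S) 1, ‖z.1‖ = 1 → 1 < ‖h (t, z)‖)
    (hent : ∀ t ∈ Icc (0 : ℝ) 1, ∀ z ∈ closedBall (0 : U × S) 1, ‖h (t, z)‖ ≤ 1 →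
      ‖(h (t, z)).2‖ ≠ 1)
    {A : U →ₗ[ℝ] U'} (h1 : ∀ z ∈ closedBall (0 : U × S) 1, h (1, z) = (A z.1, 0))
    (hA : ∀ p ∈ sphere (0 : U) 1, A p ∉ closedBall 0 1) :
    ∃ (a : ℝ × (U × S) × (U' × S') → U) (b : ℝ × (U × S) × (U' × S') → S'),
      ContinuousOn a (Icc 0 1 ×ˢ closedBall 0 1 ×ˢ closedBall 0 1) ∧
      ContinuousOn b (Icc 0 1 ×ˢ closedBall 0 1 ×ˢ closedBall 0 1) ∧
      (∀ z ∈ closedBall (0 : U × S) 1, ∀ w ∈ closedBall (0 : U' × S') 1,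
        a (1, z, w) = z.1 ∧ b (1, z, w) = w.2) ∧
      (∀ t ∈ Icc (0 : ℝ) 1, ∀ z ∈ closedBall (0 : U × S) 1, ∀ w ∈ closedBall (0 : U' × S') 1,
        a (t, z, w) = 0 → b (t, z, w) = 0 → ‖z.1‖ ≠ 1 ∧ ‖w.2‖ ≠ 1) ∧
      ∀ z ∈ closedBall (0 : U × S) 1, ∀ w ∈ closedBall (0 : U' × S') 1,
        a (0, z, w) = 0 → b (0, z, w) = 0 → h (0, z) = w := by
  have hinj : Function.Injective A := by
    rw [injective_iff_map_eq_zero]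
    intro p hp
    by_contra hne
    have := LinearMap.norm_lt_norm_of_sphere hA hne
    rw [hp, norm_zero] at this
    exact absurd this (norm_nonneg p).not_gt
  let e : U ≃L[ℝ] U' := (A.linearEquivOfInjective hinj hdim).toContinuousLinearEquiv
  have he : ∀ p, e p = A p := fun p => rfl
  have hsymm : ∀ q : U', ‖e.symm q‖ ≤ ‖q‖ := by
    intro q
    obtain ⟨p, rfl⟩ := e.surjective q
    rw [e.symm_apply_apply, he]
    rcases eq_or_ne p 0 with rfl | hp
    · simp
    · exact (LinearMap.norm_lt_norm_of_sphere hA hp).le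
  have hsymm' : ∀ q : U', q ≠ 0 → ‖e.symm q‖ < ‖q‖ := by
    intro q hq
    have h := LinearMap.norm_lt_norm_of_sphere hA (p := e.symm q) (by simpa using hq)
    rwa [← he, e.apply_symm_apply] at h
  let H : ℝ × (U × S) × (U' × S') → U' × S' := fun x => h (min (2 * x.1) 1, x.2.1)
  have hmin : ∀ t ∈ Icc (0 : ℝ) 1, min (2 * t) 1 ∈ Icc (0 : ℝ) 1 := fun t ht =>
    ⟨le_min (by linarith [ht.1]) zero_le_one, min_le_right _ _⟩
  have hH : ContinuousOn H (Icc 0 1 ×ˢ closedBall 0 1 ×ˢ closedBall 0 1) :=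
    hc.comp (f := fun x : ℝ × (U × S) × (U' × S') => (min (2 * x.1) 1, x.2.1)) (by fun_prop)
      fun x hx => ⟨hmin x.1 hx.1, hx.2.1⟩
  refine ⟨fun x => e.symm (H x).1 - (1 - max (2 * x.1 - 1) 0) • e.symm x.2.2.1,
    fun x => x.2.2.2 - (H x).2, by fun_prop, by fun_prop, ?_, ?_, ?_⟩
  · intro z hz w _
    have hm : min (2 * (1 : ℝ)) 1 = 1 := by norm_num
    have hM : max (2 * (1 : ℝ) - 1) 0 = 1 := by norm_num
    simp only [H, hm, h1 z hz, hM, ← he, e.symm_apply_apply]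
    simp
  · intro t ht z hz w hw ha hb
    simp only [H] at ha hb
    -- In the first half a boundary zero would violate the exit or the entrance condition. In the
    -- second half a zero has `w.2 = 0` and `z.1 = (2 - 2t) A⁻¹ w.1`, which has norm below 1.
    rcases le_total t (1 / 2) with ht2 | ht2
    · rw [min_eq_left (by linarith)] at ha hb
      rw [max_eq_right (by linarith), sub_zero, one_smul, sub_eq_zero, e.symm.injective.eq_iff]
        at ha
      have hw' : h (2 * t, z) = w := Prod.ext ha (sub_eq_zero.1 hb).symm
      have hwn := mem_closedBall_zero_iff.1 hw
      have ht' : 2 * t ∈ Icc (0 : ℝ) 1 := ⟨by linarith [ht.1], by linarith⟩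
      refine ⟨fun hz1 => ?_, fun hw1 => ?_⟩
      · have := hexit (2 * t) ht' z hz hz1
        rw [hw'] at this
        linarith
      · exact hent (2 * t) ht' z hz (by rwa [hw']) (by rwa [hw'])
    · rw [min_eq_right (by linarith), h1 z hz] at ha hb
      rw [max_eq_left (by linarith), ← he, e.symm_apply_apply, sub_eq_zero] at ha
      simp only [sub_zero] at hb
      refine ⟨fun hz1 => ?_, by simp [hb]⟩
      have hw1 : ‖w.1‖ ≤ 1 := (norm_fst_le w).trans (mem_closedBall_zero_iff.1 hw)
      have hc0 : 0 ≤ 1 - (2 * t - 1) := by linarith [ht.2]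
      have hc1 : 1 - (2 * t - 1) ≤ 1 := by linarith
      have hn : ‖z.1‖ ≤ ‖e.symm w.1‖ := by
        rw [ha, norm_smul, Real.norm_of_nonneg hc0]
        exact mul_le_of_le_one_left (norm_nonneg _) hc1
      have hw0 : w.1 ≠ 0 := by
        intro h0
        rw [h0, map_zero, norm_zero] at hn
        linarith
      linarith [hsymm' _ hw0]
  · intro z hz w hw ha hb
    have hm : min (2 * (0 : ℝ)) 1 = 0 := by norm_num
    have hM : max (2 * (0 : ℝ) - 1) 0 = 0 := by norm_num
    simp only [H, hm, hM, sub_zero, one_smul, sub_eq_zero, e.symm.injective.eq_iff] at ha hb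
    exact Prod.ext ha hb.symm

/-! ### Solving the links over finite windows and over `ℤ` -/

/-- Finite windows: if the equations `a i (i + 1) = 0`, `b i (i + 1) = 0` can be deformed to the
identity without zeros on the boundary, they can be solved simultaneously over a finite window. -/
theorem exists_zero_of_finite_window {U S : ℤ → Type*}
    [∀ i, NormedAddCommGroup (U i)] [∀ i, NormedSpace ℝ (U i)] [∀ i, FiniteDimensional ℝ (U i)]
    [∀ i, NormedAddCommGroup (S i)] [∀ i, NormedSpace ℝ (S i)] [∀ i, FiniteDimensional ℝ (S i)]
    (a : ∀ i j, ℝ × (U i × S i) × (U j × S j) → U i)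
    (b : ∀ i j, ℝ × (U i × S i) × (U j × S j) → S j)
    (ha : ∀ i j, j = i + 1 →
      ContinuousOn (a i j) (Icc 0 1 ×ˢ closedBall 0 1 ×ˢ closedBall 0 1))
    (hb : ∀ i j, j = i + 1 →
      ContinuousOn (b i j) (Icc 0 1 ×ˢ closedBall 0 1 ×ˢ closedBall 0 1))
    (hone : ∀ i j, j = i + 1 → ∀ z ∈ closedBall (0 : U i × S i) 1,
      ∀ w ∈ closedBall (0 : U j × S j) 1, a i j (1, z, w) = z.1 ∧ b i j (1, z, w) = w.2)
    (hne : ∀ i j, j = i + 1 → ∀ t ∈ Icc (0 : ℝ) 1, ∀ z ∈ closedBall (0 : U i × S i) 1,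
      ∀ w ∈ closedBall (0 : U j × S j) 1, a i j (t, z, w) = 0 → b i j (t, z, w) = 0 →
      ‖z.1‖ ≠ 1 ∧ ‖w.2‖ ≠ 1) (I : Finset ℤ) :
    ∃ z : ∀ i, U i × S i, (∀ i, z i ∈ closedBall (0 : U i × S i) 1) ∧
      ∀ i ∈ I, i + 1 ∈ I →
        a i (i + 1) (0, z i, z (i + 1)) = 0 ∧ b i (i + 1) (0, z i, z (i + 1)) = 0 := by
  classical
  let E := ∀ i : I, U i × S i
  -- The value 0 outside the window lies in the unit ball, so the link hypotheses apply there too.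
  let ext : E → ∀ i : ℤ, U i × S i := fun z i => if h : i ∈ I then z ⟨i, h⟩ else 0
  have hext : ∀ z (i : I), ext z i = z i := fun z i => dif_pos i.2
  have hextc : ∀ i, Continuous fun z => ext z i := by
    intro i
    by_cases h : i ∈ I
    · simp only [ext, dif_pos h]
      fun_prop
    · simp only [ext, dif_neg h]
      fun_prop
  have hextmem : ∀ z ∈ closedBall (0 : E) 1, ∀ i, ext z i ∈ closedBall (0 : U i × S i) 1 := by
    intro z hz i
    rw [mem_closedBall_zero_iff] at hz ⊢
    by_cases h : i ∈ I
    · rw [hext z ⟨i, h⟩]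
      exact (norm_le_pi_norm z _).trans hz
    · simp [ext, dif_neg h]
  -- The unstable slot of `i` carries the equation of `(i, i + 1)`, the stable slot that of `(i - 1,
  -- i)`; a slot without a neighbour in the window keeps its own coordinate, which is then 0 at a
  -- zero of `F`.
  let F : ℝ × E → E := fun x i =>
    (if (i : ℤ) + 1 ∈ I then a i (i + 1) (x.1, ext x.2 i, ext x.2 (i + 1)) else (x.2 i).1,
     if (i : ℤ) - 1 ∈ I then b (i - 1) i (x.1, ext x.2 (i - 1), ext x.2 i) else (x.2 i).2)
  have hmaps : ∀ i j : ℤ, ContinuousOn (fun x : ℝ × E => (x.1, ext x.2 i, ext x.2 j))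
      (Icc 0 1 ×ˢ closedBall 0 1) ∧ MapsTo (fun x : ℝ × E => (x.1, ext x.2 i, ext x.2 j))
      (Icc 0 1 ×ˢ closedBall 0 1) (Icc 0 1 ×ˢ closedBall 0 1 ×ˢ closedBall 0 1) := by
    intro i j
    refine ⟨Continuous.continuousOn ?_,
      fun x hx => ⟨hx.1, hextmem _ hx.2 i, hextmem _ hx.2 j⟩⟩
    exact continuous_fst.prodMk (((hextc i).comp continuous_snd).prodMk
      ((hextc j).comp continuous_snd))
  have hF : ContinuousOn F (Icc 0 1 ×ˢ closedBall 0 1) := by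
    refine continuousOn_pi.2 fun i => ContinuousOn.prodMk ?_ ?_
    · by_cases h : (i : ℤ) + 1 ∈ I
      · simp only [if_pos h]
        exact (ha i (i + 1) rfl).comp (hmaps _ _).1 (hmaps _ _).2
      · simp only [if_neg h]
        fun_prop
    · by_cases h : (i : ℤ) - 1 ∈ I
      · simp only [if_pos h]
        exact (hb (i - 1) i (by ring)).comp (hmaps _ _).1 (hmaps _ _).2
      · simp only [if_neg h]
        fun_prop
  have hzero : ∀ t z, F (t, z) = 0 → ∀ i ∈ I, i + 1 ∈ I →
      a i (i + 1) (t, ext z i, ext z (i + 1)) = 0 ∧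
        b i (i + 1) (t, ext z i, ext z (i + 1)) = 0 := by
    intro t z h0 i hi hi1
    have h1 : (F (t, z) ⟨i, hi⟩).1 = 0 := by rw [h0]; rfl
    have h2 : (F (t, z) ⟨i + 1, hi1⟩).2 = 0 := by rw [h0]; rfl
    simp only [F, if_pos hi1, add_sub_cancel_right, if_pos hi] at h1 h2
    rw [add_sub_cancel_right] at h2
    exact ⟨h1, h2⟩
  suffices h : (∀ z ∈ closedBall (0 : E) 1, F (1, z) = z) ∧
      ∀ t ∈ Icc (0 : ℝ) 1, ∀ z ∈ sphere (0 : E) 1, F (t, z) ≠ 0 by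
    obtain ⟨z, hz, hz0⟩ := exists_zero_of_homotopy_id hF h.1 h.2
    exact ⟨ext z, hextmem z hz, hzero 0 z hz0⟩
  constructor
  · intro z hz
    funext i
    have h1 := hone i (i + 1) rfl _ (hextmem z hz i) _ (hextmem z hz (i + 1))
    have h2 := hone (i - 1) i (by ring) _ (hextmem z hz (i - 1)) _ (hextmem z hz i)
    simp only [F, h1.1, h2.2]
    simp only [hext, ite_self]
  · intro t ht z hz h0
    rw [mem_sphere_zero_iff_norm] at hz
    have hzc : z ∈ closedBall (0 : E) 1 := mem_closedBall_zero_iff.2 hz.le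
    have hlt : ∀ i, ‖z i‖ < 1 := by
      intro i
      have hi : ‖z i‖ ≤ 1 := (norm_le_pi_norm z i).trans hz.le
      rw [Prod.norm_def] at hi ⊢
      refine max_lt (lt_of_le_of_ne ((le_max_left _ _).trans hi) ?_)
        (lt_of_le_of_ne ((le_max_right _ _).trans hi) ?_)
      · by_cases h : (i : ℤ) + 1 ∈ I
        · obtain ⟨h1, h2⟩ := hzero t z h0 i i.2 h
          have := (hne i (i + 1) rfl t ht _ (hextmem z hzc _) _ (hextmem z hzc _) h1 h2).1
          rwa [hext] at this
        · have h1 : (F (t, z) i).1 = 0 := by rw [h0]; rfl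
          simp only [F, if_neg h] at h1
          simp [h1]
      · by_cases h : (i : ℤ) - 1 ∈ I
        · obtain ⟨h1, h2⟩ := hzero t z h0 (i - 1) h (by simp)
          have := (hne (i - 1) (i - 1 + 1) rfl t ht _ (hextmem z hzc _) _
            (hextmem z hzc _) h1 h2).2
          rw [sub_add_cancel, hext] at this
          exact this
        · have h1 : (F (t, z) i).2 = 0 := by rw [h0]; rfl
          simp only [F, if_neg h] at h1
          simp [h1]
    have : ‖z‖ < 1 := (pi_norm_lt_iff one_pos).2 hlt
    linarith

/-- Bi-infinite version of `exists_zero_of_finite_window`, by compactness. -/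
theorem exists_zero_of_links {U S : ℤ → Type*}
    [∀ i, NormedAddCommGroup (U i)] [∀ i, NormedSpace ℝ (U i)] [∀ i, FiniteDimensional ℝ (U i)]
    [∀ i, NormedAddCommGroup (S i)] [∀ i, NormedSpace ℝ (S i)] [∀ i, FiniteDimensional ℝ (S i)]
    (a : ∀ i j, ℝ × (U i × S i) × (U j × S j) → U i)
    (b : ∀ i j, ℝ × (U i × S i) × (U j × S j) → S j)
    (ha : ∀ i j, j = i + 1 →
      ContinuousOn (a i j) (Icc 0 1 ×ˢ closedBall 0 1 ×ˢ closedBall 0 1))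
    (hb : ∀ i j, j = i + 1 →
      ContinuousOn (b i j) (Icc 0 1 ×ˢ closedBall 0 1 ×ˢ closedBall 0 1))
    (hone : ∀ i j, j = i + 1 → ∀ z ∈ closedBall (0 : U i × S i) 1,
      ∀ w ∈ closedBall (0 : U j × S j) 1, a i j (1, z, w) = z.1 ∧ b i j (1, z, w) = w.2)
    (hne : ∀ i j, j = i + 1 → ∀ t ∈ Icc (0 : ℝ) 1, ∀ z ∈ closedBall (0 : U i × S i) 1,
      ∀ w ∈ closedBall (0 : U j × S j) 1, a i j (t, z, w) = 0 → b i j (t, z, w) = 0 →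
      ‖z.1‖ ≠ 1 ∧ ‖w.2‖ ≠ 1) :
    ∃ z : ∀ i, U i × S i, (∀ i, z i ∈ closedBall (0 : U i × S i) 1) ∧
      ∀ i, a i (i + 1) (0, z i, z (i + 1)) = 0 ∧ b i (i + 1) (0, z i, z (i + 1)) = 0 := by
  let C : Set (∀ i, U i × S i) := univ.pi fun i => closedBall 0 1
  have hC : IsCompact C := isCompact_univ_pi fun i => isCompact_closedBall _ _
  let T : ℤ → Set (∀ i, U i × S i) := fun i => C ∩
    (fun z => (a i (i + 1) (0, z i, z (i + 1)), b i (i + 1) (0, z i, z (i + 1)))) ⁻¹' {0}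
  have hmaps : ∀ i : ℤ, MapsTo (fun z : ∀ i, U i × S i => ((0 : ℝ), z i, z (i + 1))) C
      (Icc 0 1 ×ˢ closedBall 0 1 ×ˢ closedBall 0 1) := fun i z hz =>
    ⟨by simp, hz i trivial, hz (i + 1) trivial⟩
  have hT : ∀ i, IsClosed (T i) := fun i =>
    (((ha i (i + 1) rfl).comp (by fun_prop) (hmaps i)).prodMk
      ((hb i (i + 1) rfl).comp (by fun_prop) (hmaps i))).preimage_isClosed_of_isClosed
      hC.isClosed isClosed_singleton
  obtain ⟨z, hzC, hzT⟩ := hC.inter_iInter_nonempty T hT (by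
    classical
    intro I
    -- The successors are added so that each equation indexed by `I` has both endpoints in the
    -- window.
    obtain ⟨z, hz, h⟩ := exists_zero_of_finite_window a b ha hb hone hne
      (I ∪ I.image (· + 1))
    refine ⟨z, fun i _ => hz i, mem_iInter₂.2 fun i hi => ⟨fun j _ => hz j, ?_⟩⟩
    obtain ⟨h1, h2⟩ := h i (Finset.mem_union_left _ hi)
      (Finset.mem_union_right _ (Finset.mem_image_of_mem _ hi))
    exact Prod.ext h1 h2)
  refine ⟨z, fun i => hzC i trivial, fun i => ?_⟩
  have := (mem_iInter.1 hzT i).2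
  exact ⟨congrArg Prod.fst this, congrArg Prod.snd this⟩

/-! ### Links between h-sets and existence of orbits -/

namespace HSet

variable {n : ℕ}

theorem box_eq_closedBall (N : HSet n) : N.box = closedBall 0 1 :=
  closedBall_prod_same _ _ _

theorem apply_mem_box_iff (N : HSet n) {x : EuclideanSpace ℝ (Fin n)} :
    N.c x ∈ N.box ↔ x ∈ N.carrier := by
  rw [box, ← N.image_eq, N.c.injective.mem_set_image]

theorem symm_apply_mem_iff (N : HSet n) {z : N.Coord} : N.c.symm z ∈ N.carrier ↔ z ∈ N.box := by
  rw [← apply_mem_box_iff, N.c.apply_symm_apply]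

/-- The data coupling the coordinates of `N` and `M`: a system of equations `a = 0`, `b = 0` on
`N_c × M_c` that implies the relation `r` and can be deformed to the identity without zeros on the
boundary. -/
def IsLink (r : EuclideanSpace ℝ (Fin n) → EuclideanSpace ℝ (Fin n) → Prop) (N M : HSet n)
    (a : ℝ × N.Coord × M.Coord → EuclideanSpace ℝ (Fin N.u))
    (b : ℝ × N.Coord × M.Coord → EuclideanSpace ℝ (Fin M.s)) : Prop :=
  ContinuousOn a (Icc 0 1 ×ˢ closedBall 0 1 ×ˢ closedBall 0 1) ∧
  ContinuousOn b (Icc 0 1 ×ˢ closedBall 0 1 ×ˢ closedBall 0 1) ∧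
  (∀ z ∈ closedBall (0 : N.Coord) 1, ∀ w ∈ closedBall (0 : M.Coord) 1,
    a (1, z, w) = z.1 ∧ b (1, z, w) = w.2) ∧
  (∀ t ∈ Icc (0 : ℝ) 1, ∀ z ∈ closedBall (0 : N.Coord) 1, ∀ w ∈ closedBall (0 : M.Coord) 1,
    a (t, z, w) = 0 → b (t, z, w) = 0 → ‖z.1‖ ≠ 1 ∧ ‖w.2‖ ≠ 1) ∧
  ∀ z ∈ closedBall (0 : N.Coord) 1, ∀ w ∈ closedBall (0 : M.Coord) 1,
    a (0, z, w) = 0 → b (0, z, w) = 0 → r (N.c.symm z) (M.c.symm w)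

theorem Covers.exists_isLink {Ω : Set (EuclideanSpace ℝ (Fin n))}
    {f : EuclideanSpace ℝ (Fin n) → EuclideanSpace ℝ (Fin n)} {N M : HSet n}
    (h : Covers Ω f N M) : ∃ a b, IsLink (fun x y => x ∈ N.carrier ∧ f x = y) N M a b := by
  obtain ⟨g, hg, h0, hexit, hent, A, h1, hA⟩ := h.exists_homotopy
  rw [box_eq_closedBall] at hg
  simp only [box_eq_closedBall] at h0 hexit hent h1
  obtain ⟨a, b, ha, hb, hone, hne, hz⟩ := exists_link_of_homotopy (by simp [h.u_eq]) hg
    (fun t ht z hz hz1 => by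
      have := hexit t ht z ⟨mem_sphere_zero_iff_norm.2 hz1,
        mem_closedBall_zero_iff.2 ((norm_snd_le z).trans (mem_closedBall_zero_iff.1 hz))⟩
      simpa using this)
    (fun t ht z hz hz1 h1 => hent t ht z hz
      ⟨mem_closedBall_zero_iff.2 ((norm_fst_le _).trans hz1), mem_sphere_zero_iff_norm.2 h1⟩)
    h1 hA
  refine ⟨a, b, ha, hb, hone, hne, fun z hzm w hw h1 h2 => ⟨?_, ?_⟩⟩
  · rwa [symm_apply_mem_iff, box_eq_closedBall]
  · rw [← hz z hzm w hw h1 h2, h0 z hzm, localRep, M.c.symm_apply_apply]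

/-- Transposition swaps stable with unstable and inversion swaps source with target, so `a` and `b`
trade places and the form of a link is preserved. -/
theorem Covers.exists_isLink_of_transpose {Ω : Set (EuclideanSpace ℝ (Fin n))}
    {g : EuclideanSpace ℝ (Fin n) → EuclideanSpace ℝ (Fin n)} {N M : HSet n}
    (h : Covers Ω g M.transpose N.transpose) :
    ∃ a b, IsLink (fun x y => y ∈ M.carrier ∧ g y = x) N M a b := by
  obtain ⟨a, b, ha, hb, hone, hne, hz⟩ := h.exists_isLink
  have hswap : ∀ {K : HSet n} {z : K.Coord}, z ∈ closedBall (0 : K.Coord) 1 →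
      (z.swap : K.transpose.Coord) ∈ closedBall (0 : K.transpose.Coord) 1 := by
    intro K z hz
    have hz' : ‖z.swap‖ ≤ 1 := by
      rw [Prod.norm_def, max_comm]
      exact mem_closedBall_zero_iff.1 hz
    exact mem_closedBall_zero_iff.2 hz'
  let σ : ℝ × N.Coord × M.Coord → ℝ × M.transpose.Coord × N.transpose.Coord :=
    fun x => (x.1, x.2.2.swap, x.2.1.swap)
  have hσ : Continuous σ := by
    exact continuous_fst.prodMk ((continuous_swap.comp (continuous_snd.comp continuous_snd)).prodMk
      (continuous_swap.comp (continuous_fst.comp continuous_snd)))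
  have hmaps : MapsTo σ (Icc 0 1 ×ˢ closedBall 0 1 ×ˢ closedBall 0 1)
      (Icc 0 1 ×ˢ closedBall 0 1 ×ˢ closedBall 0 1) :=
    fun x hx => ⟨hx.1, hswap hx.2.2, hswap hx.2.1⟩
  refine ⟨fun x => b (σ x), fun x => a (σ x), hb.comp hσ.continuousOn hmaps,
    ha.comp hσ.continuousOn hmaps, ?_, ?_, ?_⟩
  · intro z hz w hw
    exact (hone _ (hswap hw) _ (hswap hz)).symm
  · intro t ht z hz w hw h1 h2
    exact (hne t ht _ (hswap hw) _ (hswap hz) h2 h1).symm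
  · intro z hzm w hw h1 h2
    exact hz _ (hswap hw) _ (hswap hzm) h2 h1

theorem BackCovers.invFunOn_mem {Ω : Set (EuclideanSpace ℝ (Fin n))}
    {f : EuclideanSpace ℝ (Fin n) → EuclideanSpace ℝ (Fin n)} {N M : HSet n}
    (h : BackCovers Ω f N M) {y : EuclideanSpace ℝ (Fin n)} (hy : y ∈ M.carrier) :
    Function.invFunOn f Ω y ∈ Ω ∧ f (Function.invFunOn f Ω y) = y := by
  obtain ⟨x, ⟨hx, hxy⟩, -⟩ := h.existsUnique_preimage y hy
  exact Function.invFunOn_pos ⟨x, hx, hxy⟩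

theorem BackCovers.invFunOn_apply {Ω : Set (EuclideanSpace ℝ (Fin n))}
    {f : EuclideanSpace ℝ (Fin n) → EuclideanSpace ℝ (Fin n)} {N M : HSet n}
    (h : BackCovers Ω f N M) {x : EuclideanSpace ℝ (Fin n)} (hx : x ∈ Ω) (hy : f x ∈ M.carrier) :
    Function.invFunOn f Ω (f x) = x :=
  (h.existsUnique_preimage _ hy).unique (h.invFunOn_mem hy) ⟨hx, rfl⟩

end HSet

namespace HSetWithCones

variable {n : ℕ} {Ω : Set (EuclideanSpace ℝ (Fin n))}
  {f : EuclideanSpace ℝ (Fin n) → EuclideanSpace ℝ (Fin n)} {N M : HSetWithCones n}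

theorem GenCoversWithCones.exists_isLink (h : GenCoversWithCones Ω f N M) :
    ∃ a b, HSet.IsLink (fun x y => x ∈ Ω ∧ f x = y) N.toHSet M.toHSet a b := by
  rcases h with ⟨h, -⟩ | ⟨h, -⟩
  · obtain ⟨a, b, ha, hb, hone, hne, hz⟩ := h.exists_isLink
    exact ⟨a, b, ha, hb, hone, hne, fun z hzm w hw h1 h2 =>
      (hz z hzm w hw h1 h2).imp_left fun hm => h.subset_domain hm⟩
  · obtain ⟨a, b, ha, hb, hone, hne, hz⟩ := h.inverse_covers.exists_isLink_of_transpose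
    refine ⟨a, b, ha, hb, hone, hne, fun z hzm w hw h1 h2 => ?_⟩
    obtain ⟨hm, hx⟩ := hz z hzm w hw h1 h2
    simpa only [hx] using h.invFunOn_mem hm

theorem exists_orbit {K : ℤ → HSetWithCones n}
    (hK : ∀ m, GenCoversWithCones Ω f (K m) (K (m + 1))) :
    ∃ x : ℤ → EuclideanSpace ℝ (Fin n), IsOrbit Ω f x ∧ ∀ m, x m ∈ (K m).carrier := by
  have hlink : ∀ i j, j = i + 1 → ∃ a b,
      HSet.IsLink (fun x y => x ∈ Ω ∧ f x = y) (K i).toHSet (K j).toHSet a b := by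
    rintro i _ rfl
    exact (hK i).exists_isLink
  -- Pairs that are not consecutive receive the filler 0, so that `a` and `b` can be chosen for all
  -- pairs.
  have hlink' : ∀ i j, ∃ a b, j = i + 1 →
      HSet.IsLink (fun x y => x ∈ Ω ∧ f x = y) (K i).toHSet (K j).toHSet a b := by
    intro i j
    by_cases hij : j = i + 1
    · obtain ⟨a, b, h⟩ := hlink i j hij
      exact ⟨a, b, fun _ => h⟩
    · exact ⟨0, 0, fun h => absurd h hij⟩
  choose a b hab using hlink'
  obtain ⟨z, hz, h⟩ := exists_zero_of_links a b (fun i j h => (hab i j h).1)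
    (fun i j h => (hab i j h).2.1) (fun i j h => (hab i j h).2.2.1)
    (fun i j h => (hab i j h).2.2.2.1)
  refine ⟨fun m => (K m).c.symm (z m), fun m => ?_, fun m => ?_⟩
  · exact (hab m (m + 1) rfl).2.2.2.2 _ (hz m) _ (hz (m + 1)) (h m).1 (h m).2
  · rw [HSet.symm_apply_mem_iff, HSet.box_eq_closedBall]
    exact hz m

/-! ### Cone conditions and growth of the gap -/

theorem continuous_Q (N : HSetWithCones n) : Continuous N.Q := by
  have h : ∀ {d : ℕ} (q : QuadraticForm ℝ (EuclideanSpace ℝ (Fin d))), Continuous q := by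
    intro d q
    have hq : ∀ x, q x = LinearMap.toContinuousLinearMap.toLinearMap.comp
      (QuadraticMap.associated q) x x := fun x => (QuadraticMap.associated_eq_self_apply ℝ q x).symm
    rw [show (q : _ → ℝ) = _ from funext hq]
    exact (LinearMap.continuous_of_finiteDimensional
      (LinearMap.toContinuousLinearMap.toLinearMap.comp (QuadraticMap.associated q))).clm_apply
      continuous_id
  exact ((h N.α).comp continuous_fst).sub ((h N.β).comp continuous_snd)

theorem Q_zero (N : HSetWithCones n) : N.Q 0 = 0 := by
  simp [Q]

/-- The value of the quadratic form of `N` on the difference of two points in coordinates. -/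
noncomputable def gap (N : HSetWithCones n) (x x' : EuclideanSpace ℝ (Fin n)) : ℝ := N.Q (N.c x - N.c x')

theorem gap_self (N : HSetWithCones n) (x : EuclideanSpace ℝ (Fin n)) : N.gap x x = 0 := by
  rw [gap, sub_self, Q_zero]

theorem continuous_gap (N : HSetWithCones n) :
    Continuous fun p : EuclideanSpace ℝ (Fin n) × EuclideanSpace ℝ (Fin n) => N.gap p.1 p.2 :=
  N.continuous_Q.comp ((N.c.continuous.comp continuous_fst).sub (N.c.continuous.comp continuous_snd))

theorem exists_abs_gap_le (N : HSetWithCones n) :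
    ∃ B, ∀ x ∈ N.carrier, ∀ x' ∈ N.carrier, |N.gap x x'| ≤ B := by
  obtain ⟨B, hB⟩ := (N.isCompact.prod N.isCompact).exists_bound_of_continuousOn
    N.continuous_gap.continuousOn
  exact ⟨B, fun x hx x' hx' => hB (x, x') ⟨hx, hx'⟩⟩

theorem exists_pos_le_of_continuousOn {X : Type*} [TopologicalSpace X] {s : Set X}
    (hs : IsCompact s) {g : X → ℝ} (hg : ContinuousOn g s) (h : ∀ x ∈ s, 0 < g x) :
    ∃ δ > 0, ∀ x ∈ s, δ ≤ g x := by
  rcases s.eq_empty_or_nonempty with rfl | hne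
  · exact ⟨1, one_pos, by simp⟩
  · obtain ⟨x, hx, hmin⟩ := hs.exists_isMinOn hne hg
    exact ⟨g x, h x hx, hmin⟩

theorem ConeCondition.gap_lt (h : ConeCondition f N M) {x x' : EuclideanSpace ℝ (Fin n)}
    (hx : x ∈ N.carrier) (hx' : x' ∈ N.carrier) (hne : x ≠ x') :
    N.gap x x' < M.gap (f x) (f x') := by
  have := h _ (N.apply_mem_box_iff.2 hx) _ (N.apply_mem_box_iff.2 hx') (N.c.injective.ne hne)
  simp only [HSet.localRep, Homeomorph.symm_apply_apply] at this
  exact this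

theorem BackConeCondition.gap_lt (h : BackConeCondition Ω f N M)
    {y y' : EuclideanSpace ℝ (Fin n)} (hy : y ∈ M.carrier) (hy' : y' ∈ M.carrier) (hne : y ≠ y') :
    N.gap (Function.invFunOn f Ω y) (Function.invFunOn f Ω y') < M.gap y y' := by
  have := h _ (M.apply_mem_box_iff.2 hy) _ (M.apply_mem_box_iff.2 hy') (M.c.injective.ne hne)
  simp only [HSet.localRep, Homeomorph.symm_apply_apply] at this
  exact this

theorem GenCoversWithCones.gap_lt (h : GenCoversWithCones Ω f N M)
    {x x' : EuclideanSpace ℝ (Fin n)} (hx : x ∈ Ω) (hx' : x' ∈ Ω) (hxN : x ∈ N.carrier)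
    (hxN' : x' ∈ N.carrier) (hM : f x ∈ M.carrier) (hM' : f x' ∈ M.carrier) (hne : x ≠ x') :
    N.gap x x' < M.gap (f x) (f x') := by
  rcases h with ⟨-, hc⟩ | ⟨h, hc⟩
  · exact hc.gap_lt hxN hxN' hne
  · have hf : f x ≠ f x' := fun hff => hne <| by
      rw [← h.invFunOn_apply hx hM, hff, h.invFunOn_apply hx' hM']
    have := hc.gap_lt hM hM' hf
    rwa [h.invFunOn_apply hx hM, h.invFunOn_apply hx' hM'] at this

/-- The pairs with `|gap| ≥ ε` form a compact set off the diagonal, where the strict inequality has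
a positive minimum. The sign `σ` serves both directions: `1` for `f`, `-1` for its inverse. -/
theorem exists_pos_forall_add_gap_le {g : EuclideanSpace ℝ (Fin n) → EuclideanSpace ℝ (Fin n)}
    {K K' : HSetWithCones n} {σ : ℝ} (hg : ContinuousOn g K.carrier)
    (hlt : ∀ x ∈ K.carrier, ∀ x' ∈ K.carrier, x ≠ x' →
      0 < σ * (K'.gap (g x) (g x') - K.gap x x')) {ε : ℝ} (hε : 0 < ε) :
    ∃ δ > 0, ∀ x ∈ K.carrier, ∀ x' ∈ K.carrier, ε ≤ |K.gap x x'| →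
      δ ≤ σ * (K'.gap (g x) (g x') - K.gap x x') := by
  have hcompact : IsCompact ((K.carrier ×ˢ K.carrier) ∩
      {p : EuclideanSpace ℝ (Fin n) × EuclideanSpace ℝ (Fin n) | ε ≤ |K.gap p.1 p.2|}) :=
    (K.isCompact.prod K.isCompact).inter_right (isClosed_le continuous_const K.continuous_gap.abs)
  have hpair : ContinuousOn
      (fun p : EuclideanSpace ℝ (Fin n) × EuclideanSpace ℝ (Fin n) => (g p.1, g p.2))
      (K.carrier ×ˢ K.carrier) := hg.prodMap hg
  have hcont : ContinuousOn (fun p : EuclideanSpace ℝ (Fin n) × EuclideanSpace ℝ (Fin n) =>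
      σ * (K'.gap (g p.1) (g p.2) - K.gap p.1 p.2)) (K.carrier ×ˢ K.carrier) :=
    continuousOn_const.mul
      ((K'.continuous_gap.comp_continuousOn hpair).sub K.continuous_gap.continuousOn)
  obtain ⟨δ, hδ, hle⟩ := exists_pos_le_of_continuousOn hcompact (hcont.mono inter_subset_left)
    (fun p hp => hlt _ hp.1.1 _ hp.1.2 fun heq => by
      have h0 : ε ≤ |K.gap p.1 p.2| := hp.2
      rw [heq, gap_self, abs_zero] at h0
      linarith)
  exact ⟨δ, hδ, fun x hx x' hx' h => hle (x, x') ⟨⟨hx, hx'⟩, h⟩⟩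

/-- The bound by `ε` is required at both ends because covering uses compactness in `N`,
back-covering in `M`. -/
theorem GenCoversWithCones.exists_gap_add_le (h : GenCoversWithCones Ω f N M) {ε : ℝ}
    (hε : 0 < ε) : ∃ δ > 0, ∀ x ∈ Ω, ∀ x' ∈ Ω, x ∈ N.carrier → x' ∈ N.carrier →
      f x ∈ M.carrier → f x' ∈ M.carrier → ε ≤ |N.gap x x'| → ε ≤ |M.gap (f x) (f x')| →
      N.gap x x' + δ ≤ M.gap (f x) (f x') := by
  rcases h with ⟨h, hc⟩ | ⟨h, hc⟩
  · obtain ⟨δ, hδ, hle⟩ := exists_pos_forall_add_gap_le (σ := 1) (K' := M) h.continuousOn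
      (fun x hx x' hx' hne => by linarith [hc.gap_lt hx hx' hne]) hε
    refine ⟨δ, hδ, fun x _ x' _ hxN hxN' _ _ h1 _ => ?_⟩
    linarith [hle x hxN x' hxN' h1]
  · obtain ⟨δ, hδ, hle⟩ := exists_pos_forall_add_gap_le (σ := -1) (K := M) (K' := N)
      h.inverse_covers.continuousOn
      (fun y hy y' hy' hne => by linarith [hc.gap_lt hy hy' hne]) hε
    refine ⟨δ, hδ, fun x hx x' hx' _ _ hM hM' _ h2 => ?_⟩
    have := hle _ hM _ hM' h2
    rw [h.invFunOn_apply hx hM, h.invFunOn_apply hx' hM'] at this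
    linarith

end HSetWithCones

/-- A bounded monotone sequence of reals that grows by a definite amount wherever it stays away
from zero vanishes identically. -/
theorem eq_zero_of_monotone_of_abs_le {V : ℤ → ℝ} (hV : Monotone V) {B : ℝ} (hB : ∀ m, |V m| ≤ B)
    (h : ∀ ε > 0, ∃ δ > 0, ∀ m, ε ≤ |V m| → ε ≤ |V (m + 1)| → V m + δ ≤ V (m + 1)) (m : ℤ) :
    V m = 0 := by
  by_contra hm
  obtain ⟨δ, hδ, hstep⟩ := h |V m| (abs_pos.2 hm)
  obtain ⟨j, hj⟩ := exists_nat_gt ((B - V m) / δ)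
  obtain ⟨j', hj'⟩ := exists_nat_gt ((B + V m) / δ)
  rw [div_lt_iff₀ hδ] at hj hj'
  rcases lt_or_gt_of_ne hm with hneg | hpos
  -- A negative value only moves further from zero backwards in time, a positive one forwards;
  -- either way steps of size `δ` eventually violate the bound `B`.
  · have key : ∀ i : ℕ, V (m - i) + i * δ ≤ V m := by
      intro i
      induction i with
      | zero => simp
      | succ i ih =>
        have h1 : V (m - i) ≤ V m := hV (by omega)
        have h2 : V (m - (i + 1 : ℕ)) ≤ V m := hV (by omega)
        have h3 := hstep (m - (i + 1 : ℕ))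
        rw [show m - ((i + 1 : ℕ) : ℤ) + 1 = m - i by push_cast; ring] at h3
        have h4 := h3 (abs_le_abs_of_nonpos (by linarith) h2)
          (abs_le_abs_of_nonpos (by linarith) h1)
        push_cast at h4 ⊢
        linarith
    have := key j'
    have := (abs_le.1 (hB (m - j'))).1
    linarith
  · have key : ∀ i : ℕ, V m + i * δ ≤ V (m + i) := by
      intro i
      induction i with
      | zero => simp
      | succ i ih =>
        have h1 : V m ≤ V (m + i) := hV (by omega)
        have h2 : V m ≤ V (m + i + 1) := hV (by omega)
        have h4 := hstep (m + i) (abs_le_abs_of_nonneg hpos.le h1)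
          (abs_le_abs_of_nonneg hpos.le h2)
        push_cast
        rw [← add_assoc]
        linarith
    have := key j
    have := (abs_le.1 (hB (m + j))).2
    linarith

end

/-! ### The orbit realizing a given itinerary -/

theorem mainTheorem7 {n k : ℕ} (A : Matrix (Fin k) (Fin k) ℕ)
    (hA : ∀ i j, A i j = 0 ∨ A i j = 1)
    (Ω : Set (EuclideanSpace ℝ (Fin n)))
    (f : EuclideanSpace ℝ (Fin n) → EuclideanSpace ℝ (Fin n))
    (N : Fin k → HSetWithCones n)
    (hN : ∀ i j, A i j = 1 → HSetWithCones.GenCoversWithCones Ω f (N i) (N j)) :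
    ∀ ω ∈ markovSequences A,
      ∃! x : ℤ → EuclideanSpace ℝ (Fin n),
        IsOrbit Ω f x ∧ ∀ m, x m ∈ (N (ω m)).carrier := by
  intro ω hω
  have hK : ∀ m, HSetWithCones.GenCoversWithCones Ω f (N (ω m)) (N (ω (m + 1))) :=
    fun m => hN _ _ (hω m)
  obtain ⟨x, hx, hxN⟩ := HSetWithCones.exists_orbit (K := fun m => N (ω m)) hK
  refine ⟨x, ⟨hx, hxN⟩, ?_⟩
  rintro y ⟨hy, hyN⟩
  let V : ℤ → ℝ := fun m => (N (ω m)).gap (x m) (y m)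
  have hlt : ∀ m, x m ≠ y m → V m < V (m + 1) := by
    intro m hne
    have := (hK m).gap_lt (hx m).1 (hy m).1 (hxN m) (hyN m) (by rw [(hx m).2]; exact hxN _)
      (by rw [(hy m).2]; exact hyN _) hne
    rwa [(hx m).2, (hy m).2] at this
  have hmono : Monotone V := by
    refine monotone_int_of_le_succ fun m => ?_
    -- Orbits that agree at time `m` agree at `m + 1`, so both gaps are 0.
    by_cases hne : x m = y m
    · have h1 : x (m + 1) = y (m + 1) := by rw [← (hx m).2, ← (hy m).2, hne]
      simp only [V, hne, h1, HSetWithCones.gap_self, le_refl]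
    · exact (hlt m hne).le
  choose B hB using fun i => (N i).exists_abs_gap_le
  obtain ⟨C, hC⟩ := (Set.finite_range B).bddAbove
  have hzero := eq_zero_of_monotone_of_abs_le hmono
    (fun m => (hB (ω m) _ (hxN m) _ (hyN m)).trans (hC (Set.mem_range_self _))) (by
      intro ε hε
      have hpair : ∀ i j, ∃ δ > 0, A i j = 1 → ∀ x ∈ Ω, ∀ x' ∈ Ω, x ∈ (N i).carrier →
          x' ∈ (N i).carrier → f x ∈ (N j).carrier → f x' ∈ (N j).carrier →
          ε ≤ |(N i).gap x x'| → ε ≤ |(N j).gap (f x) (f x')| →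
          (N i).gap x x' + δ ≤ (N j).gap (f x) (f x') := by
        intro i j
        by_cases hij : A i j = 1
        · obtain ⟨δ, hδ, h⟩ := (hN i j hij).exists_gap_add_le hε
          exact ⟨δ, hδ, fun _ => h⟩
        · exact ⟨1, one_pos, fun h => absurd h hij⟩
      choose δ hδ hstep using hpair
      -- The increment must not depend on `m`: the least one over the finitely many pairs of symbols
      -- serves, forbidden pairs carrying the filler 1.
      obtain ⟨p, hp⟩ := @Finite.exists_min (Fin k × Fin k) ℝ _ ⟨(ω 0, ω 0)⟩ _
        (fun p => δ p.1 p.2)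
      refine ⟨δ p.1 p.2, hδ _ _, fun m h1 h2 => ?_⟩
      have h3 := hstep _ _ (hω m) (x m) (hx m).1 (y m) (hy m).1 (hxN m) (hyN m)
        (by rw [(hx m).2]; exact hxN _) (by rw [(hy m).2]; exact hyN _) h1
      rw [(hx m).2, (hy m).2] at h3
      have h4 : δ p.1 p.2 ≤ δ (ω m) (ω (m + 1)) := hp (ω m, ω (m + 1))
      have h5 : V m + δ (ω m) (ω (m + 1)) ≤ V (m + 1) := h3 h2
      linarith)
  funext m
  by_contra hne
  have := hlt m (Ne.symm hne)
  rw [hzero m, hzero (m + 1)] at this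
  exact lt_irrefl _ this
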